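/- Theorem. There is a function $\alpha\mapsto\kappa_\alpha$ from $(0,\infty)$ to $\mathbb{R}$, strictly increasing in $\alpha$ and with $\kappa_1\le 10$, such that the following holds for all $\alpha>0$, all natural numbers $d$ and all $\ell\le d^2$. Let $V_1,\dots,V_{d^2}$ be any orthonormal basis of $\mathbb{C}^{d\times d}$ with respect to the Hilbert--Schmidt inner product $\langle A,B\rangle=\operatorname{Tr}(A^\dagger B)$, let $z_1,\dots,z_{d^2}$ be independent random variables, each equal to $1$ or $-1$ with probability $1/2$, and let $W=\sum_{i=1}^{\ell} z_iV_i$. Then $$\Pr\left[\|W\|_{\mathrm{op}}>\kappa_\alpha\sqrt d\,\right]\le 2e^{-\alpha d},$$ where $\|\cdot\|_{\mathrm{op}}$ is the operator norm induced by the Euclidean norm on $\mathbb{C}^d$ (the largest singular value). In particular $\kappa_\alpha$ depends only on $\alpha$, not on $d$, $\ell$ or the basis. -/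

import Mathlib

open MeasureTheory ProbabilityTheory Matrix

/-- A family of complex `d × d` matrices is an orthonormal basis of `ℂ^{d × d}` for the
Hilbert-Schmidt inner product `⟨A, B⟩ = Tr (A† B)`. -/
structure IsHSOrthonormalBasis {ι : Type*} [DecidableEq ι] {d : ℕ}
    (V : ι → Matrix (Fin d) (Fin d) ℂ) : Prop where
  trace_conjTranspose_mul : ∀ i j, ((V i)ᴴ * V j).trace = if i = j then 1 else 0
  span_eq_top : Submodule.span ℂ (Set.range V) = ⊤

/-- A symmetric Bernoulli (Rademacher) random variable: it takes each of the values `1` and `-1`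
with probability `1 / 2`. -/
structure IsRademacher {Ω : Type*} [MeasurableSpace Ω] (X : Ω → ℝ) (μ : Measure Ω) : Prop where
  measurable : Measurable X
  prob_one : μ {ω | X ω = 1} = 1 / 2
  prob_neg_one : μ {ω | X ω = -1} = 1 / 2

/-- The operator norm of a complex square matrix with respect to the Euclidean norm on `ℂ^d`
(its largest singular value). -/
noncomputable def matrixOpNorm {d : ℕ} (A : Matrix (Fin d) (Fin d) ℂ) : ℝ :=
  ‖Matrix.toEuclideanCLM (n := Fin d) (𝕜 := ℂ) A‖

/-- The matrix `W = ∑_{i ≤ ℓ} z_i V_i`, the sum of the first `ℓ` terms (the indices of `Fin`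
start at `0`). -/
noncomputable def signedPartialSum {d : ℕ} (V : Fin (d ^ 2) → Matrix (Fin d) (Fin d) ℂ) (ℓ : ℕ)
    (z : Fin (d ^ 2) → ℝ) : Matrix (Fin d) (Fin d) ℂ :=
  ∑ i : Fin (d ^ 2) with i.val < ℓ, (z i : ℂ) • V i

/-! An ε-net argument combined with Hoeffding's inequality. For fixed u, v in the unit ball, Re⟨u, W
v⟩ is a Rademacher sum with weights Re⟨u, V_i v⟩. Since ⟨u, V_i v⟩ is, up to conjugation, the
Hilbert–Schmidt product of V_i with the rank one matrix u v†, Bessel bounds the sum of squared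
weights by 1, whatever the basis, d and ℓ. So each form has a dimension-free Gaussian tail. A
1/4-net reduces the operator norm to at most 9^(4d) pairs (u, v), and taking t of order √d lets the
tail beat this count. -/

open Module in
/-- A finite `ε`-separated subset of the unit ball of an `n`-dimensional real normed space has at
most `(1 + 2 / ε) ^ n` points. -/
theorem card_le_of_separated_of_norm_le_one {E : Type*} [NormedAddCommGroup E] [NormedSpace ℝ E]
    [FiniteDimensional ℝ E] {ε : ℝ} (hε : 0 < ε) (s : Finset E) (hs : ∀ x ∈ s, ‖x‖ ≤ 1)
    (hsep : ∀ x ∈ s, ∀ y ∈ s, x ≠ y → ε ≤ ‖x - y‖) :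
    (s.card : ℝ) ≤ (1 + 2 / ε) ^ finrank ℝ E := by
  borelize E
  let μ : Measure E := Measure.addHaar
  have hδ : 0 < ε / 2 := by positivity
  have hρ : 0 < 1 + ε / 2 := by positivity
  have hdisj : Set.Pairwise (s : Set E)
      (Function.onFun Disjoint fun x => Metric.ball (x : E) (ε / 2)) := by
    intro x hx y hy hxy
    apply Metric.ball_disjoint_ball
    rw [dist_eq_norm, add_halves]
    exact hsep x hx y hy hxy
  have hsub : (⋃ x ∈ s, Metric.ball (x : E) (ε / 2)) ⊆ Metric.ball 0 (1 + ε / 2) := by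
    refine Set.iUnion₂_subset fun x hx => Metric.ball_subset_ball' ?_
    rw [dist_zero_right]
    linarith [hs x hx]
  -- Disjoint balls of radius ε/2 fit in a ball of radius 1 + ε/2; the unit ball's volume then
  -- cancels.
  have hvol : (s.card : ENNReal) * ENNReal.ofReal ((ε / 2) ^ finrank ℝ E) * μ (Metric.ball 0 1) ≤
      ENNReal.ofReal ((1 + ε / 2) ^ finrank ℝ E) * μ (Metric.ball 0 1) :=
    calc
      _ = μ (⋃ x ∈ s, Metric.ball (x : E) (ε / 2)) := by
        rw [measure_biUnion_finset hdisj fun x _ => measurableSet_ball]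
        simp only [μ.addHaar_ball_of_pos _ hδ, Finset.sum_const, nsmul_eq_mul, mul_assoc]
      _ ≤ μ (Metric.ball 0 (1 + ε / 2)) := measure_mono hsub
      _ = _ := μ.addHaar_ball_of_pos _ hρ
  have hle := (ENNReal.mul_le_mul_iff_left (Metric.measure_ball_pos _ _ zero_lt_one).ne'
    measure_ball_lt_top.ne).1 hvol
  have hreal := ENNReal.toReal_le_of_le_ofReal (pow_nonneg hρ.le _) hle
  rw [ENNReal.toReal_mul, ENNReal.toReal_natCast, ENNReal.toReal_ofReal (by positivity),
    ← le_div_iff₀ (by positivity), ← div_pow] at hreal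
  have hdiv : (1 + ε / 2) / (ε / 2) = 1 + 2 / ε := by field_simp; ring
  rwa [hdiv] at hreal

open Module in
/-- The unit ball of an `n`-dimensional real normed space has an `ε`-net with at most
`(1 + 2 / ε) ^ n` points. -/
theorem exists_net_unit_ball (E : Type*) [NormedAddCommGroup E] [NormedSpace ℝ E]
    [FiniteDimensional ℝ E] {ε : ℝ} (hε : 0 < ε) :
    ∃ s : Finset E, (∀ x ∈ s, ‖x‖ ≤ 1) ∧ (∀ x : E, ‖x‖ ≤ 1 → ∃ y ∈ s, ‖x - y‖ ≤ ε) ∧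
      (s.card : ℝ) ≤ (1 + 2 / ε) ^ finrank ℝ E := by
  classical
  let P : Finset E → Prop := fun s =>
    (∀ x ∈ s, ‖x‖ ≤ 1) ∧ ∀ x ∈ s, ∀ y ∈ s, x ≠ y → ε ≤ ‖x - y‖
  have hbound : ∀ s, P s → (s.card : ℝ) ≤ (1 + 2 / ε) ^ finrank ℝ E := fun s hs =>
    card_le_of_separated_of_norm_le_one hε s hs.1 hs.2
  have hbdd : BddAbove {k | ∃ s, P s ∧ s.card = k} := by
    refine ⟨⌊(1 + 2 / ε) ^ finrank ℝ E⌋₊, ?_⟩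
    rintro _ ⟨s, hs, rfl⟩
    exact Nat.le_floor (hbound s hs)
  -- A separated set of maximal cardinality is a net: a point far from all of it could be added.
  obtain ⟨s, hs, hcard⟩ : sSup {k | ∃ s, P s ∧ s.card = k} ∈ {k | ∃ s, P s ∧ s.card = k} :=
    Nat.sSup_mem ⟨0, ∅, by simp [P], rfl⟩ hbdd
  refine ⟨s, hs.1, fun x hx => ?_, hbound s hs⟩
  by_contra! hfar
  have hxs : x ∉ s := fun h => by
    have := hfar x h
    simp only [sub_self, norm_zero] at this
    exact lt_asymm hε this
  have hins : P (insert x s) := by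
    refine ⟨by simpa [hx] using hs.1, ?_⟩
    intro a ha b hb hab
    rcases Finset.mem_insert.1 ha with rfl | ha' <;> rcases Finset.mem_insert.1 hb with rfl | hb'
    · exact absurd rfl hab
    · exact (hfar b hb').le
    · rw [norm_sub_rev]
      exact (hfar a ha').le
    · exact hs.2 a ha' b hb' hab
  have hmax := le_csSup hbdd ⟨_, hins, rfl⟩
  rw [Finset.card_insert_of_notMem hxs, ← hcard] at hmax
  omega

/-- The operator norm is controlled by the values of the sesquilinear form on a `1 / 4`-net of the
unit ball. -/
theorem opNorm_le_of_re_inner_le_on_net {E : Type*} [NormedAddCommGroup E] [InnerProductSpace ℂ E]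
    (s : Finset E) (hs : ∀ x ∈ s, ‖x‖ ≤ 1)
    (hnet : ∀ x : E, ‖x‖ ≤ 1 → ∃ y ∈ s, ‖x - y‖ ≤ 1 / 4) (T : E →L[ℂ] E) {M : ℝ}
    (hM : ∀ u ∈ s, ∀ v ∈ s, (inner ℂ u (T v)).re ≤ M) : ‖T‖ ≤ 2 * M := by
  have key : ∀ x y : E, ‖x‖ ≤ 1 → ‖y‖ ≤ 1 → (inner ℂ x (T y)).re ≤ M + ‖T‖ / 2 := by
    intro x y hx hy
    obtain ⟨u, hu, hxu⟩ := hnet x hx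
    obtain ⟨v, hv, hyv⟩ := hnet y hy
    -- Each of the two approximation errors costs ‖T‖/4, and their sum ‖T‖/2 is absorbed on the left
    -- at the end.
    have hsplit : inner ℂ x (T y) =
        inner ℂ u (T v) + (inner ℂ u (T (y - v)) + inner ℂ (x - u) (T y)) := by
      rw [map_sub, inner_sub_right, inner_sub_left]
      ring
    have h1 : (inner ℂ u (T (y - v))).re ≤ ‖T‖ / 4 := by
      calc _ ≤ ‖u‖ * ‖T (y - v)‖ := re_inner_le_norm (𝕜 := ℂ) _ _
        _ ≤ 1 * (‖T‖ * (1 / 4)) := by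
          gcongr
          · exact hs u hu
          · exact T.le_opNorm_of_le hyv
        _ = _ := by ring
    have h2 : (inner ℂ (x - u) (T y)).re ≤ ‖T‖ / 4 := by
      calc _ ≤ ‖x - u‖ * ‖T y‖ := re_inner_le_norm (𝕜 := ℂ) _ _
        _ ≤ (1 / 4) * (‖T‖ * 1) := by
          gcongr
          exact T.le_opNorm_of_le hy
        _ = _ := by ring
    rw [hsplit, Complex.add_re, Complex.add_re]
    linarith [hM u hu v hv]
  have hC : 0 ≤ M + ‖T‖ / 2 := by simpa using key 0 0 (by simp) (by simp)
  have hle : ‖T‖ ≤ M + ‖T‖ / 2 := by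
    refine ContinuousLinearMap.opNorm_le_of_re_inner_le (𝕜 := ℂ) hC fun x y hx hy => ?_
    rw [inner_re_symm]
    exact key y x hy.le hx.le
  linarith

/-- **Bessel's inequality** for a family of matrices that is orthonormal for the Hilbert-Schmidt
inner product, tested against a rank one matrix. -/
theorem sum_normSq_inner_toEuclideanCLM_le {ι : Type*} [DecidableEq ι] {d : ℕ}
    {V : ι → Matrix (Fin d) (Fin d) ℂ}
    (hV : ∀ i j, ((V i)ᴴ * V j).trace = if i = j then 1 else 0) (s : Finset ι)
    (u v : EuclideanSpace ℂ (Fin d)) :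
    ∑ i ∈ s, ‖inner ℂ u (Matrix.toEuclideanCLM (n := Fin d) (𝕜 := ℂ) (V i) v)‖ ^ 2
      ≤ (‖u‖ * ‖v‖) ^ 2 := by
  let e : ι → EuclideanSpace ℂ (Fin d × Fin d) := fun i => WithLp.toLp 2 fun p => V i p.1 p.2
  let x : EuclideanSpace ℂ (Fin d × Fin d) := WithLp.toLp 2 fun p => u p.1 * star (v p.2)
  have he : Orthonormal ℂ e := by
    rw [orthonormal_iff_ite]
    intro i j
    rw [← hV i j]
    simp only [PiLp.inner_apply, Matrix.trace, Matrix.diag, Matrix.mul_apply, e,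
      Fintype.sum_prod_type, Matrix.conjTranspose_apply]
    rw [Finset.sum_comm]
    refine Finset.sum_congr rfl fun a _ => Finset.sum_congr rfl fun b _ => ?_
    simp [mul_comm]
  have hx : ‖x‖ ^ 2 = (‖u‖ * ‖v‖) ^ 2 := by
    rw [mul_pow, EuclideanSpace.norm_sq_eq, EuclideanSpace.norm_sq_eq, EuclideanSpace.norm_sq_eq,
      Fintype.sum_prod_type, Finset.sum_mul_sum]
    simp [x, mul_pow]
  have hinner : ∀ i, ‖inner ℂ u (Matrix.toEuclideanCLM (n := Fin d) (𝕜 := ℂ) (V i) v)‖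
      = ‖inner ℂ (e i) x‖ := by
    intro i
    rw [norm_inner_symm (e i) x]
    congr 1
    simp only [PiLp.inner_apply, x, e, Fintype.sum_prod_type, Matrix.ofLp_toEuclideanCLM,
      Matrix.mulVec, dotProduct, RCLike.inner_apply, Finset.sum_mul]
    refine Finset.sum_congr rfl fun a _ => Finset.sum_congr rfl fun b _ => ?_
    simp
    ring
  simp only [hinner, ← hx]
  exact he.sum_inner_products_le x

theorem IsRademacher.ae_eq_one_or {Ω : Type*} [MeasurableSpace Ω] {μ : Measure Ω}
    [IsProbabilityMeasure μ] {X : Ω → ℝ} (hX : IsRademacher X μ) :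
    ∀ᵐ ω ∂μ, X ω = 1 ∨ X ω = -1 := by
  have h1 : MeasurableSet {ω | X ω = 1} := hX.measurable (measurableSet_singleton 1)
  have h2 : MeasurableSet {ω | X ω = -1} := hX.measurable (measurableSet_singleton (-1))
  have hdisj : Disjoint {ω | X ω = 1} {ω | X ω = -1} := by
    rw [Set.disjoint_left]
    intro ω (h : X ω = 1) (h' : X ω = -1)
    linarith
  have huniv : μ ({ω | X ω = 1} ∪ {ω | X ω = -1}) = 1 := by
    rw [measure_union hdisj h2, hX.prob_one, hX.prob_neg_one, ENNReal.add_halves]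
  exact (prob_compl_eq_zero_iff (h1.union h2)).2 huniv

theorem IsRademacher.integral_eq_zero {Ω : Type*} [MeasurableSpace Ω] {μ : Measure Ω}
    [IsProbabilityMeasure μ] {X : Ω → ℝ} (hX : IsRademacher X μ) : ∫ ω, X ω ∂μ = 0 := by
  have h1 : MeasurableSet {ω | X ω = 1} := hX.measurable (measurableSet_singleton 1)
  have h2 : MeasurableSet {ω | X ω = -1} := hX.measurable (measurableSet_singleton (-1))
  have hae : X =ᵐ[μ] fun ω => {ω | X ω = 1}.indicator (fun _ => (1 : ℝ)) ω
      - {ω | X ω = -1}.indicator (fun _ => (1 : ℝ)) ω := by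
    filter_upwards [hX.ae_eq_one_or] with ω hω
    rcases hω with h | h <;> norm_num [Set.indicator, h]
  rw [integral_congr_ae hae, integral_sub ((integrable_const _).indicator h1)
    ((integrable_const _).indicator h2), integral_indicator_const _ h1,
    integral_indicator_const _ h2, measureReal_def, measureReal_def, hX.prob_one, hX.prob_neg_one,
    sub_self]

theorem IsRademacher.hasSubgaussianMGF {Ω : Type*} [MeasurableSpace Ω] {μ : Measure Ω}
    [IsProbabilityMeasure μ] {X : Ω → ℝ} (hX : IsRademacher X μ) : HasSubgaussianMGF X 1 μ := by
  have h := hasSubgaussianMGF_of_mem_Icc_of_integral_eq_zero (a := -1) (b := 1)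
    hX.measurable.aemeasurable
    (by filter_upwards [hX.ae_eq_one_or] with ω hω; rcases hω with h | h <;> norm_num [h])
    hX.integral_eq_zero
  -- Hoeffding's lemma gives the parameter ((1 - (-1)) / 2)² = 1.
  convert h
  ext
  norm_num

/-- **Hoeffding's inequality** for a Rademacher sum with square-summable weights. -/
theorem measureReal_rademacher_sum_ge_le {Ω ι : Type*} [MeasurableSpace Ω] {μ : Measure Ω}
    [IsProbabilityMeasure μ] {z : ι → Ω → ℝ} (hz : ∀ i, IsRademacher (z i) μ)
    (hind : iIndepFun z μ) (s : Finset ι) (a : ι → ℝ) (ha : ∑ i ∈ s, a i ^ 2 ≤ 1) {t : ℝ}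
    (ht : 0 ≤ t) : μ.real {ω | t ≤ ∑ i ∈ s, a i * z i ω} ≤ Real.exp (-t ^ 2 / 2) := by
  have hind' : iIndepFun (fun i ω => a i * z i ω) μ :=
    hind.comp (fun i x => a i * x) fun i => measurable_const_mul (a i)
  have hsum := HasSubgaussianMGF.sum_of_iIndepFun hind' (s := s)
    fun i _ => (hz i).hasSubgaussianMGF.const_mul (a i)
  have hone : HasSubgaussianMGF (fun ω => ∑ i ∈ s, a i * z i ω) 1 μ := by
    refine ⟨hsum.integrable_exp_mul, fun r => (hsum.mgf_le r).trans ?_⟩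
    gcongr
    rw [← NNReal.coe_le_coe, NNReal.coe_sum, NNReal.coe_one]
    refine (Finset.sum_congr rfl fun i _ => ?_).trans_le ha
    exact mul_one (a i ^ 2)
  simpa using hone.measure_ge_le ht

theorem re_inner_signedPartialSum {d : ℕ} (V : Fin (d ^ 2) → Matrix (Fin d) (Fin d) ℂ) (ℓ : ℕ)
    (z : Fin (d ^ 2) → ℝ) (u v : EuclideanSpace ℂ (Fin d)) :
    (inner ℂ u (Matrix.toEuclideanCLM (n := Fin d) (𝕜 := ℂ) (signedPartialSum V ℓ z) v)).re =
      ∑ i : Fin (d ^ 2) with i.val < ℓ,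
        (inner ℂ u (Matrix.toEuclideanCLM (n := Fin d) (𝕜 := ℂ) (V i) v)).re * z i := by
  simp only [signedPartialSum, map_sum, map_smul, _root_.sum_apply,
    _root_.smul_apply, inner_sum, inner_smul_right, Complex.re_sum,
    Complex.re_ofReal_mul]
  simp only [mul_comm]

/-- Tail bound for the operator norm of a Rademacher sum of Hilbert-Schmidt orthonormal matrices,
from a net of at most `9 ^ (2 * d)` points. -/
theorem measure_matrixOpNorm_signedPartialSum_gt_le {d : ℕ}
    {V : Fin (d ^ 2) → Matrix (Fin d) (Fin d) ℂ} (hV : IsHSOrthonormalBasis V) (ℓ : ℕ)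
    {Ω : Type*} [MeasurableSpace Ω] {μ : Measure Ω} [IsProbabilityMeasure μ]
    {z : Fin (d ^ 2) → Ω → ℝ} (hz : ∀ i, IsRademacher (z i) μ) (hind : iIndepFun z μ) {t : ℝ}
    (ht : 0 ≤ t) :
    μ {ω | matrixOpNorm (signedPartialSum V ℓ (fun i => z i ω)) > t} ≤
      ENNReal.ofReal (9 ^ (4 * d) * Real.exp (-t ^ 2 / 8)) := by
  obtain ⟨s, hs, hnet, hcard⟩ := exists_net_unit_ball (EuclideanSpace ℂ (Fin d))
    (ε := 1 / 4) (by norm_num)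
  have hrank : Module.finrank ℝ (EuclideanSpace ℂ (Fin d)) = 2 * d := by
    rw [finrank_real_of_complex, finrank_euclideanSpace_fin]
  rw [hrank] at hcard
  norm_num at hcard
  -- Bad event for one pair; the threshold t/2 offsets the factor 2 lost in passing to the net.
  let B : EuclideanSpace ℂ (Fin d) × EuclideanSpace ℂ (Fin d) → Set Ω := fun p =>
    {ω | t / 2 ≤ ∑ i : Fin (d ^ 2) with i.val < ℓ,
      (inner ℂ p.1 (Matrix.toEuclideanCLM (n := Fin d) (𝕜 := ℂ) (V i) p.2)).re * z i ω}
  have hB : ∀ p ∈ s ×ˢ s, μ.real (B p) ≤ Real.exp (-t ^ 2 / 8) := by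
    intro p hp
    rw [Finset.mem_product] at hp
    have hsq : ∑ i : Fin (d ^ 2) with i.val < ℓ,
        (inner ℂ p.1 (Matrix.toEuclideanCLM (n := Fin d) (𝕜 := ℂ) (V i) p.2)).re ^ 2 ≤ 1 := by
      calc _ ≤ ∑ i : Fin (d ^ 2) with i.val < ℓ,
            ‖inner ℂ p.1 (Matrix.toEuclideanCLM (n := Fin d) (𝕜 := ℂ) (V i) p.2)‖ ^ 2 :=
            Finset.sum_le_sum fun i _ => sq_le_sq' (neg_le_of_abs_le (Complex.abs_re_le_norm _))
              (Complex.re_le_norm _)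
        _ ≤ (‖p.1‖ * ‖p.2‖) ^ 2 :=
            sum_normSq_inner_toEuclideanCLM_le hV.trace_conjTranspose_mul _ _ _
        _ ≤ 1 := pow_le_one₀ (by positivity)
            (mul_le_one₀ (hs _ hp.1) (norm_nonneg _) (hs _ hp.2))
    refine (measureReal_rademacher_sum_ge_le hz hind _ _ hsq (by positivity)).trans_eq ?_
    congr 1
    ring
  have hsub : {ω | matrixOpNorm (signedPartialSum V ℓ (fun i => z i ω)) > t} ⊆
      ⋃ p ∈ s ×ˢ s, B p := by
    intro ω hω
    by_contra hnot
    simp only [Set.mem_iUnion, not_exists, B, Set.mem_ofPred_eq, not_le, Finset.mem_product] at hnot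
    have hle := opNorm_le_of_re_inner_le_on_net s hs hnet
      (Matrix.toEuclideanCLM (n := Fin d) (𝕜 := ℂ) (signedPartialSum V ℓ (fun i => z i ω)))
      (M := t / 2) fun u hu v hv => by
        rw [re_inner_signedPartialSum]
        exact (hnot (u, v) ⟨hu, hv⟩).le
    rw [mul_div_cancel₀ t two_ne_zero] at hle
    exact not_lt.2 hle hω
  rw [← ofReal_measureReal]
  apply ENNReal.ofReal_le_ofReal
  calc _ ≤ μ.real (⋃ p ∈ s ×ˢ s, B p) := measureReal_mono hsub (measure_ne_top _ _)
    _ ≤ ∑ p ∈ s ×ˢ s, μ.real (B p) := measureReal_biUnion_finset_le _ _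
    _ ≤ ∑ p ∈ s ×ˢ s, Real.exp (-t ^ 2 / 8) := Finset.sum_le_sum hB
    _ = (s.card * s.card) * Real.exp (-t ^ 2 / 8) := by
      rw [Finset.sum_const, Finset.card_product, nsmul_eq_mul, Nat.cast_mul]
    _ ≤ (9 ^ (2 * d) * 9 ^ (2 * d)) * Real.exp (-t ^ 2 / 8) := by gcongr
    _ = _ := by rw [← pow_add]; ring_nf

theorem mainTheorem5 :
    ∃ κ : ℝ → ℝ, StrictMonoOn κ (Set.Ioi 0) ∧ κ 1 ≤ 10 ∧
      ∀ α : ℝ, 0 < α → ∀ d ℓ : ℕ, ℓ ≤ d ^ 2 →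
        ∀ V : Fin (d ^ 2) → Matrix (Fin d) (Fin d) ℂ, IsHSOrthonormalBasis V →
          ∀ (Ω : Type*) [MeasurableSpace Ω] (μ : Measure Ω) [IsProbabilityMeasure μ]
            (z : Fin (d ^ 2) → Ω → ℝ), (∀ i, IsRademacher (z i) μ) → iIndepFun z μ →
            μ {ω | matrixOpNorm (signedPartialSum V ℓ (fun i => z i ω)) > κ α * √(d : ℝ)}
              ≤ ENNReal.ofReal (2 * Real.exp (-(α * d))) := by
  have hlog : 0 < Real.log 9 := Real.log_pos (by norm_num)
  -- Chosen so that κ²/8 = α + 4 log 9: the second term cancels the factor 9^(4d) exactly.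
  refine ⟨fun α => √(8 * (α + 4 * Real.log 9)), ?_, ?_, ?_⟩
  · intro α (hα : 0 < α) β _ hαβ
    exact Real.sqrt_lt_sqrt (by positivity) (by linarith)
  -- From 9 ≤ 16, κ₁² ≤ 8(1 + 16 log 2) < 100.
  · have hlog9 : Real.log 9 ≤ 4 * Real.log 2 := by
      rw [← Real.log_rpow two_pos]
      exact Real.log_le_log (by norm_num) (by norm_num)
    apply Real.sqrt_le_iff.2
    constructor <;> linarith [Real.log_two_lt_d9]
  · intro α hα d ℓ _ V hV Ω _ μ _ z hz hind
    refine (measure_matrixOpNorm_signedPartialSum_gt_le hV ℓ hz hind (by positivity)).trans ?_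
    apply ENNReal.ofReal_le_ofReal
    have hexp : -(√(8 * (α + 4 * Real.log 9)) * √(d : ℝ)) ^ 2 / 8
        = -(α * d) - (4 * d : ℕ) * Real.log 9 := by
      rw [mul_pow, Real.sq_sqrt (by positivity), Real.sq_sqrt (by positivity)]
      push_cast
      ring
    have hpow : (9 : ℝ) ^ (4 * d) = Real.exp ((4 * d : ℕ) * Real.log 9) := by
      rw [Real.exp_nat_mul, Real.exp_log (by norm_num)]
    rw [hexp, hpow, ← Real.exp_add, add_sub_cancel]
    linarith [Real.exp_pos (-(α * d))]
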